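/- Fix a finite set $\Sigma$ of propositions. A finite timed word over $\Sigma$ is a non-empty finite sequence $\rho=(\sigma_1,\tau_1)\dots(\sigma_n,\tau_n)$ with $\emptyset\neq\sigma_i\subseteq\Sigma$ and $0=\tau_1\le\tau_2\le\dots\le\tau_n$ in $\mathbb R$. MTL formulae are $\varphi::=a\mid\top\mid\varphi\wedge\varphi\mid\neg\varphi\mid\varphi\,\mathsf U_I\,\varphi\mid\varphi\,\mathsf S_I\,\varphi$, where $a\in\Sigma$ and $I$ is a non-empty open, half-open or closed interval with end points in $\mathbb N\cup\{\infty\}$. They have the strict pointwise semantics: $\rho,i\models\varphi_1\mathsf U_I\varphi_2$ iff there is $j>i$ with $\rho,j\models\varphi_2$, $\tau_j-\tau_i\in I$ and $\rho,k\models\varphi_1$ for all $i<k<j$; $\mathsf S_I$ is symmetric, with $j<i$ and $\tau_i-\tau_j\in I$. PMTL consists of the MTL formulae in which no $\mathsf S$ carries a punctual interval $[x,x]$, together with those in which no $\mathsf U$ does. Formulae of 1-TPTL (in negation normal form, with one freeze variable $x$) are $\varphi::=a\mid\neg a\mid\top\mid\bot\mid x.\varphi\mid T-x\in I\mid x-T\in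 I\mid\varphi\wedge\varphi\mid\varphi\vee\varphi\mid\varphi\,\mathsf U\,\varphi\mid\varphi\,\mathsf S\,\varphi\mid\Box\varphi\mid\boxminus\varphi$, where $I$ is a non-empty interval with end points in $\mathbb Z\cup\{\pm\infty\}$. At position $i$, $x.\varphi$ evaluates $\varphi$ with $x:=\tau_i$, and $T-x\in I$ says $\tau_i-x\in I$ (and $x-T\in I$ says $x-\tau_i\in I$). The modalities $\mathsf U,\mathsf S,\Box,\boxminus$ are strict, and $\Diamond\varphi=\top\,\mathsf U\,\varphi$. Intervals $I,J$ are non-adjacent (positively non-adjacent, negatively non-adjacent) if $\sup I=\inf J$ implies $\sup I=0$ ($\sup I\le0$, $\sup I\ge0$) and $\inf I=\sup J$ implies $\inf I=0$ ($\inf I\le0$, $\inf I\ge0$). A formula is non-adjacent (positively, negatively non-adjacent) if, for each freeze quantifier in it, any two, possibly equal, intervals of the constraints bound by that quantifier are so related, where $x-T\in I$ is counted as $T-x\in -I$. PA-1-TPTL consists of the formulae that are positively non-adjacent or negatively non-adjacent. The language of a formula is the set of timed words satisfying it at position $1$ (with $x=0$ initially, for 1-TPTL). **Theorem.** (i) For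 every PMTL formula over $\Sigma$ there is a PA-1-TPTL formula over $\Sigma$ with the same language. (ii) If $a,b,c\in\Sigma$ are distinct, then the formula $$\psi=\Diamond\bigl[a\wedge x.\Diamond\bigl(b\wedge T-x\in(1,2)\wedge\Diamond(c\wedge T-x\in(1,2))\bigr)\bigr]$$ is non-adjacent and belongs to PA-1-TPTL, and no MTL formula over $\Sigma$ has the same language as $\psi$. Hence the class of PMTL-definable languages over $\Sigma$ is a proper subclass of the class of PA-1-TPTL-definable languages over $\Sigma$: PA-1-TPTL is strictly more expressive than PMTL. -/

import Mathlib

namespace TimedLogic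

/-! ### Timed words -/

/-- A finite timed word over the propositions `S`: a non-empty sequence of `last + 1` pairs of a
non-empty set of propositions and a time stamp. The time stamps are weakly increasing and start
with `0` (hence they are non-negative). The first position is `0 : Fin (last + 1)`. -/
structure TimedWord (S : Type*) where
  last : ℕ
  label : Fin (last + 1) → Set S
  label_nonempty : ∀ i, (label i).Nonempty
  time : Fin (last + 1) → ℝ
  time_zero : time 0 = 0
  time_mono : Monotone time

/-- The positions of a timed word. -/
abbrev TimedWord.Pos {S : Type*} (ρ : TimedWord S) : Type := Fin (ρ.last + 1)

/-! ### Time intervals -/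

/-- `e` is an element of `ℤ ∪ {-∞, ∞}`. -/
def IsIntEndpoint (e : EReal) : Prop :=
  e = ⊥ ∨ e = ⊤ ∨ ∃ n : ℤ, e = ((n : ℝ) : EReal)

/-- `e` is an element of `ℕ ∪ {∞}`. -/
def IsNatEndpoint (e : EReal) : Prop :=
  e = ⊤ ∨ ∃ n : ℕ, e = ((n : ℝ) : EReal)

/-- Membership of a real number in the interval with end points `lo` and `hi`, each of which
belongs to the interval or not. (An infinite end point never contributes a real number.) -/
def MemInterval (lo hi : EReal) (loClosed hiClosed : Prop) (t : ℝ) : Prop :=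
  (lo < (t : EReal) ∨ loClosed ∧ lo = (t : EReal)) ∧
    ((t : EReal) < hi ∨ hiClosed ∧ (t : EReal) = hi)

/-- A (non-empty) open, half-open or closed interval of reals with end points in
`ℤ ∪ {-∞, ∞}`. As the interval is non-empty, its infimum is `lo` and its supremum is `hi`. -/
structure IntInterval where
  lo : EReal
  hi : EReal
  loClosed : Prop
  hiClosed : Prop
  lo_int : IsIntEndpoint lo
  hi_int : IsIntEndpoint hi
  nonempty : ∃ t : ℝ, MemInterval lo hi loClosed hiClosed t

namespace IntInterval

/-- The set of reals denoted by an interval. -/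
def toSet (I : IntInterval) : Set ℝ :=
  {t | MemInterval I.lo I.hi I.loClosed I.hiClosed t}

/-- A punctual interval is one of the form `[x, x]`. -/
def IsPunctual (I : IntInterval) : Prop := I.lo = I.hi

theorem isIntEndpoint_neg {e : EReal} (h : IsIntEndpoint e) : IsIntEndpoint (-e) := by
  rcases h with rfl | rfl | ⟨n, rfl⟩
  · exact Or.inr (Or.inl EReal.neg_bot)
  · exact Or.inl EReal.neg_top
  · exact Or.inr (Or.inr ⟨-n, by push_cast; rfl⟩)

theorem memInterval_neg {lo hi : EReal} {p q : Prop} {t : ℝ} (h : MemInterval lo hi p q t) :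
    MemInterval (-hi) (-lo) q p (-t) := by
  obtain ⟨h1, h2⟩ := h
  refine ⟨?_, ?_⟩
  · rcases h2 with h2 | ⟨hq, h2⟩
    · exact Or.inl (by rw [EReal.coe_neg]; exact EReal.neg_lt_neg_iff.2 h2)
    · exact Or.inr ⟨hq, by rw [EReal.coe_neg, h2]⟩
  · rcases h1 with h1 | ⟨hp, h1⟩
    · exact Or.inl (by rw [EReal.coe_neg]; exact EReal.neg_lt_neg_iff.2 h1)
    · exact Or.inr ⟨hp, by rw [EReal.coe_neg, h1]⟩

/-- The reflected interval `-I = {-t | t ∈ I}`. -/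
noncomputable def reflect (I : IntInterval) : IntInterval where
  lo := -I.hi
  hi := -I.lo
  loClosed := I.hiClosed
  hiClosed := I.loClosed
  lo_int := isIntEndpoint_neg I.hi_int
  hi_int := isIntEndpoint_neg I.lo_int
  nonempty := I.nonempty.imp' (fun t => -t) fun _ h => memInterval_neg h

/-- The open interval `(m, n)` for integers `m < n`. -/
noncomputable def ioo (m n : ℤ) (h : m < n) : IntInterval where
  lo := ((m : ℝ) : EReal)
  hi := ((n : ℝ) : EReal)
  loClosed := False
  hiClosed := False
  lo_int := Or.inr (Or.inr ⟨m, rfl⟩)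
  hi_int := Or.inr (Or.inr ⟨n, rfl⟩)
  nonempty := by
    obtain ⟨t, h1, h2⟩ := exists_between (Int.cast_lt (R := ℝ).2 h)
    exact ⟨t, Or.inl (EReal.coe_lt_coe_iff.2 h1), Or.inl (EReal.coe_lt_coe_iff.2 h2)⟩

/-- Non-adjacency of two intervals. -/
def NonAdjacent (I J : IntInterval) : Prop :=
  (I.hi = J.lo → I.hi = 0) ∧ (I.lo = J.hi → I.lo = 0)

/-- Positive non-adjacency of two intervals. -/
def PosNonAdjacent (I J : IntInterval) : Prop :=
  (I.hi = J.lo → I.hi ≤ 0) ∧ (I.lo = J.hi → I.lo ≤ 0)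

/-- Negative non-adjacency of two intervals. -/
def NegNonAdjacent (I J : IntInterval) : Prop :=
  (I.hi = J.lo → 0 ≤ I.hi) ∧ (I.lo = J.hi → 0 ≤ I.lo)

end IntInterval

/-- The intervals with end points in `ℕ ∪ {∞}`. -/
def NatInterval : Type :=
  {I : IntInterval // IsNatEndpoint I.lo ∧ IsNatEndpoint I.hi}

/-! ### Metric Temporal Logic -/

/-- Formulae of `MTL[U_I, S_I]`. -/
inductive MTL (S : Type*) where
  | atom (a : S) : MTL S
  | tru : MTL S
  | and (φ ψ : MTL S) : MTL S
  | neg (φ : MTL S) : MTL S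
  | untl (I : NatInterval) (φ ψ : MTL S) : MTL S
  | snce (I : NatInterval) (φ ψ : MTL S) : MTL S

namespace MTL

variable {S : Type*}

/-- Pointwise semantics (with strict until and since): `φ.Sat ρ i` is `ρ, i ⊨ φ`. -/
def Sat (ρ : TimedWord S) : MTL S → ρ.Pos → Prop
  | atom a, i => a ∈ ρ.label i
  | tru, _ => True
  | and φ ψ, i => Sat ρ φ i ∧ Sat ρ ψ i
  | neg φ, i => ¬ Sat ρ φ i
  | untl I φ ψ, i => ∃ j, i < j ∧ Sat ρ ψ j ∧ ρ.time j - ρ.time i ∈ I.1.toSet ∧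
      ∀ k, i < k → k < j → Sat ρ φ k
  | snce I φ ψ, i => ∃ j, j < i ∧ Sat ρ ψ j ∧ ρ.time i - ρ.time j ∈ I.1.toSet ∧
      ∀ k, j < k → k < i → Sat ρ φ k

/-- The language of an MTL formula. -/
def language (φ : MTL S) : Set (TimedWord S) := {ρ | Sat ρ φ 0}

/-- No until modality of the formula carries a punctual interval. -/
def UntilNonPunctual : MTL S → Prop
  | atom _ => True
  | tru => True
  | and φ ψ => UntilNonPunctual φ ∧ UntilNonPunctual ψ
  | neg φ => UntilNonPunctual φ
  | untl I φ ψ => ¬ I.1.IsPunctual ∧ UntilNonPunctual φ ∧ UntilNonPunctual ψ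
  | snce _ φ ψ => UntilNonPunctual φ ∧ UntilNonPunctual ψ

/-- No since modality of the formula carries a punctual interval. -/
def SinceNonPunctual : MTL S → Prop
  | atom _ => True
  | tru => True
  | and φ ψ => SinceNonPunctual φ ∧ SinceNonPunctual ψ
  | neg φ => SinceNonPunctual φ
  | untl _ φ ψ => SinceNonPunctual φ ∧ SinceNonPunctual ψ
  | snce I φ ψ => ¬ I.1.IsPunctual ∧ SinceNonPunctual φ ∧ SinceNonPunctual ψ

/-- Partially punctual MTL: the union of `MTL[U_I, S_np]` and `MTL[U_np, S_I]`. -/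
def IsPMTL (φ : MTL S) : Prop := SinceNonPunctual φ ∨ UntilNonPunctual φ

end MTL

/-! ### One variable TPTL in negation normal form -/

/-- Formulae of `1-TPTL` in negation normal form; the only freeze variable is `x`. -/
inductive TPTL1 (S : Type*) where
  | atom (a : S) : TPTL1 S
  | natom (a : S) : TPTL1 S
  | tru : TPTL1 S
  | fls : TPTL1 S
  /-- `x.φ` -/
  | freeze (φ : TPTL1 S) : TPTL1 S
  /-- `T - x ∈ I` -/
  | constr (I : IntInterval) : TPTL1 S
  /-- `x - T ∈ I` -/
  | constrRev (I : IntInterval) : TPTL1 S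
  | and (φ ψ : TPTL1 S) : TPTL1 S
  | or (φ ψ : TPTL1 S) : TPTL1 S
  | untl (φ ψ : TPTL1 S) : TPTL1 S
  | snce (φ ψ : TPTL1 S) : TPTL1 S
  | box (φ : TPTL1 S) : TPTL1 S
  | boxPast (φ : TPTL1 S) : TPTL1 S

namespace TPTL1

variable {S : Type*}

/-- Pointwise semantics: `φ.Sat ρ i v` is `ρ, i, v ⊨ φ`, where `v` is the value of `x`. -/
def Sat (ρ : TimedWord S) : TPTL1 S → ρ.Pos → ℝ → Prop
  | atom a, i, _ => a ∈ ρ.label i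
  | natom a, i, _ => a ∉ ρ.label i
  | tru, _, _ => True
  | fls, _, _ => False
  | freeze φ, i, _ => Sat ρ φ i (ρ.time i)
  | constr I, i, v => ρ.time i - v ∈ I.toSet
  | constrRev I, i, v => v - ρ.time i ∈ I.toSet
  | and φ ψ, i, v => Sat ρ φ i v ∧ Sat ρ ψ i v
  | or φ ψ, i, v => Sat ρ φ i v ∨ Sat ρ ψ i v
  | untl φ ψ, i, v => ∃ j, i < j ∧ Sat ρ ψ j v ∧ ∀ k, i < k → k < j → Sat ρ φ k v
  | snce φ ψ, i, v => ∃ j, j < i ∧ Sat ρ ψ j v ∧ ∀ k, j < k → k < i → Sat ρ φ k v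
  | box φ, i, v => ∀ j, i < j → Sat ρ φ j v
  | boxPast φ, i, v => ∀ j, j < i → Sat ρ φ j v

/-- The language of a `1-TPTL` formula; initially the freeze variable has the value `0`. -/
def language (φ : TPTL1 S) : Set (TimedWord S) := {ρ | Sat ρ φ 0 0}

/-- The future eventuality `◇ φ = ⊤ U φ`. -/
def dia (φ : TPTL1 S) : TPTL1 S := untl tru φ

/-- The intervals of those constraints in `φ` that do not lie below a freeze quantifier in `φ`.
These are the constraints of `x.φ` that belong to the outermost freeze quantifier of `x.φ`.
The constraint `x - T ∈ I` is the constraint `T - x ∈ -I`, and counts with the interval `-I`. -/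
noncomputable def outerIntervals : TPTL1 S → Set IntInterval
  | atom _ => ∅
  | natom _ => ∅
  | tru => ∅
  | fls => ∅
  | freeze _ => ∅
  | constr I => {I}
  | constrRev I => {I.reflect}
  | and φ ψ => outerIntervals φ ∪ outerIntervals ψ
  | or φ ψ => outerIntervals φ ∪ outerIntervals ψ
  | untl φ ψ => outerIntervals φ ∪ outerIntervals ψ
  | snce φ ψ => outerIntervals φ ∪ outerIntervals ψ
  | box φ => outerIntervals φ
  | boxPast φ => outerIntervals φ

/-- For every freeze quantifier in the formula, any two (possibly equal) intervals of constraints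
belonging to that quantifier are in relation `R`. -/
def ScopesSatisfy (R : IntInterval → IntInterval → Prop) : TPTL1 S → Prop
  | atom _ => True
  | natom _ => True
  | tru => True
  | fls => True
  | freeze φ =>
      (∀ I ∈ outerIntervals φ, ∀ J ∈ outerIntervals φ, R I J) ∧ ScopesSatisfy R φ
  | constr _ => True
  | constrRev _ => True
  | and φ ψ => ScopesSatisfy R φ ∧ ScopesSatisfy R ψ
  | or φ ψ => ScopesSatisfy R φ ∧ ScopesSatisfy R ψ
  | untl φ ψ => ScopesSatisfy R φ ∧ ScopesSatisfy R ψ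
  | snce φ ψ => ScopesSatisfy R φ ∧ ScopesSatisfy R ψ
  | box φ => ScopesSatisfy R φ
  | boxPast φ => ScopesSatisfy R φ

/-- Non-adjacent `1-TPTL`. -/
def IsNA (φ : TPTL1 S) : Prop := ScopesSatisfy IntInterval.NonAdjacent φ

/-- Positively non-adjacent `1-TPTL`. -/
def IsNAPos (φ : TPTL1 S) : Prop := ScopesSatisfy IntInterval.PosNonAdjacent φ

/-- Negatively non-adjacent `1-TPTL`. -/
def IsNANeg (φ : TPTL1 S) : Prop := ScopesSatisfy IntInterval.NegNonAdjacent φ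

/-- Partially adjacent `1-TPTL`. -/
def IsPA (φ : TPTL1 S) : Prop := IsNAPos φ ∨ IsNANeg φ

/-- The formula `◇ [a ∧ x.◇ (b ∧ T - x ∈ (1,2) ∧ ◇ (c ∧ T - x ∈ (1,2)))]`. -/
noncomputable def separating (a b c : S) : TPTL1 S :=
  dia (and (atom a) (freeze (dia
    (and (atom b) (and (constr (IntInterval.ioo 1 2 (by norm_num)))
      (dia (and (atom c) (constr (IntInterval.ioo 1 2 (by norm_num))))))))))

end TPTL1

/-- The languages of timed words over `S` that are definable in partially punctual MTL. -/
def PMTLDefinable (S : Type*) : Set (Set (TimedWord S)) :=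
  {L | ∃ φ : MTL S, φ.IsPMTL ∧ φ.language = L}

/-- The languages of timed words over `S` that are definable in partially adjacent `1-TPTL`. -/
def PADefinable (S : Type*) : Set (Set (TimedWord S)) :=
  {L | ∃ φ : TPTL1 S, φ.IsPA ∧ φ.language = L}

end TimedLogic

namespace TimedLogic

/-! For (i), each modality of an MTL formula becomes a 1-TPTL modality with its own freeze
quantifier, and negations are pushed inwards (`MTL.toTPTL1`). A scope then holds either the single
interval `I` of the modality or the two rays of its complement. These can be adjacent only when `I`
is punctual, and then only at a nonnegative point for until and, after reflection, at a nonpositive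
point for since. So banning punctual since gives negative non-adjacency, and banning punctual until
gives positive non-adjacency.

For (ii), consider the word `abcabc…` with period `1 - ε`, each `b` trailing its `a` by `ε/2` and
each `c` by `1/2`. The first `b` more than one unit after an `a` lies two periods later, and the
following `c` is then beyond two units, so the separating formula fails. Moving one `a` in the
middle forward by `3ε/4` puts the `b` of the next period just beyond distance 1, and the formula
holds. MTL cannot see this move, by an Ehrenfeucht–Fraïssé argument (`TameTimes.forth`,
`TameTimes.back`, `MTL.sat_iff_of_agree`). Far from the ends only the residue modulo 3 of a position
matters: a floor of the distance that occurs for a letter in one word can be realised with the same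
letter in the other, since steps of three positions take less than one unit. No distance between
distinct positions is an integer (`nonIntegral_abcTime`), so intervals see only floors. -/

/-! ### Translation of MTL into negation normal form 1-TPTL. -/

open scoped Classical in
/-- The formula saying that the constraint `c` holds for the interval with the given end points;
it is `⊥` if the interval is empty. -/
noncomputable def TPTL1.constrOrFalse {S : Type*} (c : IntInterval → TPTL1 S) (lo hi : EReal)
    (p q : Prop) (hlo : IsIntEndpoint lo) (hhi : IsIntEndpoint hi) : TPTL1 S :=
  if h : ∃ t, MemInterval lo hi p q t then c ⟨lo, hi, p, q, hlo, hhi, h⟩ else TPTL1.fls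

/-- The formula saying that the constraint `c` holds for one of the two rays that form the
complement of `I`. -/
noncomputable def TPTL1.outside {S : Type*} (c : IntInterval → TPTL1 S) (I : IntInterval) :
    TPTL1 S :=
  TPTL1.or
    (TPTL1.constrOrFalse c ⊥ I.lo False (¬ I.loClosed) (Or.inl rfl) I.lo_int)
    (TPTL1.constrOrFalse c I.hi ⊤ (¬ I.hiClosed) False I.hi_int (Or.inr (Or.inl rfl)))

theorem not_memInterval_iff (lo hi : EReal) (p q : Prop) (t : ℝ) :
    (MemInterval ⊥ lo False (¬ p) t ∨ MemInterval hi ⊤ (¬ q) False t) ↔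
      ¬ MemInterval lo hi p q t := by
  have hb : (⊥ : EReal) < t := EReal.bot_lt_coe t
  have ht : (t : EReal) < ⊤ := EReal.coe_lt_top t
  unfold MemInterval
  rcases lt_trichotomy lo (t : EReal) with h1 | h1 | h1 <;>
    rcases lt_trichotomy (t : EReal) hi with h2 | h2 | h2 <;> grind

theorem TPTL1.sat_constrOrFalse {S : Type*} {ρ : TimedWord S} {c : IntInterval → TPTL1 S}
    {i : ρ.Pos} {v t : ℝ} (hc : ∀ J, TPTL1.Sat ρ (c J) i v ↔ t ∈ J.toSet) (lo hi : EReal)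
    (p q : Prop) (hlo : IsIntEndpoint lo) (hhi : IsIntEndpoint hi) :
    TPTL1.Sat ρ (TPTL1.constrOrFalse c lo hi p q hlo hhi) i v ↔ MemInterval lo hi p q t := by
  unfold TPTL1.constrOrFalse
  split_ifs with h
  · exact hc _
  · exact ⟨fun h' => h'.elim, fun h' => (h ⟨t, h'⟩).elim⟩

theorem TPTL1.sat_outside {S : Type*} {ρ : TimedWord S} {c : IntInterval → TPTL1 S}
    {i : ρ.Pos} {v t : ℝ} (hc : ∀ J, TPTL1.Sat ρ (c J) i v ↔ t ∈ J.toSet) (I : IntInterval) :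
    TPTL1.Sat ρ (TPTL1.outside c I) i v ↔ t ∉ I.toSet := by
  refine Iff.trans ?_ (not_memInterval_iff I.lo I.hi I.loClosed I.hiClosed t)
  exact or_congr (TPTL1.sat_constrOrFalse hc ..) (TPTL1.sat_constrOrFalse hc ..)

/-- A formula of `1-TPTL` equivalent to an MTL formula, together with one equivalent to its
negation. -/
noncomputable def MTL.toTPTL1 {S : Type*} : MTL S → TPTL1 S × TPTL1 S
  | .atom a => (.atom a, .natom a)
  | .tru => (.tru, .fls)
  | .and φ ψ => (.and φ.toTPTL1.1 ψ.toTPTL1.1, .or φ.toTPTL1.2 ψ.toTPTL1.2)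
  | .neg φ => (φ.toTPTL1.2, φ.toTPTL1.1)
  | .untl I φ ψ =>
      (.freeze (.untl φ.toTPTL1.1 (.and ψ.toTPTL1.1 (.constr I.1))),
       .freeze (.or (.box (.or ψ.toTPTL1.2 (.outside .constr I.1)))
        (.untl (.or ψ.toTPTL1.2 (.outside .constr I.1))
          (.and φ.toTPTL1.2 (.or ψ.toTPTL1.2 (.outside .constr I.1))))))
  | .snce I φ ψ =>
      (.freeze (.snce φ.toTPTL1.1 (.and ψ.toTPTL1.1 (.constrRev I.1))),
       .freeze (.or (.boxPast (.or ψ.toTPTL1.2 (.outside .constrRev I.1)))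
        (.snce (.or ψ.toTPTL1.2 (.outside .constrRev I.1))
          (.and φ.toTPTL1.2 (.or ψ.toTPTL1.2 (.outside .constrRev I.1))))))

/-- The negation normal form of a negated strict until over a well-founded linear order. -/
theorem not_until_iff {α : Type*} [LinearOrder α] [WellFoundedLT α] (P Q : α → Prop) (i : α) :
    ((∀ j, i < j → ¬ Q j) ∨ ∃ j, i < j ∧ (¬ P j ∧ ¬ Q j) ∧ ∀ k, i < k → k < j → ¬ Q k) ↔
      ¬ ∃ j, i < j ∧ Q j ∧ ∀ k, i < k → k < j → P k := by
  constructor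
  · rintro (h | ⟨j, hij, ⟨hP, hQ⟩, hk⟩) ⟨l, hil, hl, hPl⟩
    · exact h l hil hl
    · rcases lt_trichotomy j l with h | rfl | h
      · exact hP (hPl j hij h)
      · exact hQ hl
      · exact hk l hil h hl
  · intro h
    by_cases hex : ∃ j, i < j ∧ Q j
    · right
      -- At the first `Q` after `i`, the until can fail only because `P` fails strictly earlier,
      -- where `Q` has not yet occurred.
      obtain ⟨j, ⟨hij, hQ⟩, hmin⟩ :=
        WellFounded.has_min (wellFounded_lt (α := α)) {j | i < j ∧ Q j} hex
      have hno : ∀ k, i < k → k < j → ¬ Q k := fun k h1 h2 h3 => hmin k ⟨h1, h3⟩ h2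
      by_contra hcon
      refine h ⟨j, hij, hQ, fun k h1 h2 => ?_⟩
      by_contra hP
      exact hcon ⟨k, h1, ⟨hP, hno k h1 h2⟩, fun l h3 h4 => hno l h3 (h4.trans h2)⟩
    · left
      intro j hij hQ
      exact hex ⟨j, hij, hQ⟩

theorem MTL.sat_toTPTL1 {S : Type*} (ρ : TimedWord S) (φ : MTL S) (i : ρ.Pos) (v : ℝ) :
    (TPTL1.Sat ρ φ.toTPTL1.1 i v ↔ MTL.Sat ρ φ i) ∧
      (TPTL1.Sat ρ φ.toTPTL1.2 i v ↔ ¬ MTL.Sat ρ φ i) := by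
  induction φ generalizing i v with
  | atom a => exact ⟨Iff.rfl, Iff.rfl⟩
  | tru => exact ⟨Iff.rfl, by simp [MTL.toTPTL1, TPTL1.Sat, MTL.Sat]⟩
  | and φ ψ h1 h2 =>
    simp only [MTL.toTPTL1, TPTL1.Sat, MTL.Sat, h1, h2]
    exact ⟨trivial, by tauto⟩
  | neg φ h => simp only [MTL.toTPTL1, MTL.Sat, h, not_not, and_self]
  | untl I φ ψ h1 h2 =>
    have hout : ∀ j : ρ.Pos, TPTL1.Sat ρ (.outside .constr I.1) j (ρ.time i) ↔
      ρ.time j - ρ.time i ∉ I.1.toSet := fun j => TPTL1.sat_outside (fun _ => Iff.rfl) _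
    simp only [MTL.toTPTL1, TPTL1.Sat, MTL.Sat, h1, h2, hout, and_assoc, true_and, ← not_and_or]
    have := not_until_iff (fun j => MTL.Sat ρ φ j)
      (fun j => MTL.Sat ρ ψ j ∧ ρ.time j - ρ.time i ∈ I.1.toSet) i
    simpa only [and_assoc] using this
  | snce I φ ψ h1 h2 =>
    have hout : ∀ j : ρ.Pos, TPTL1.Sat ρ (.outside .constrRev I.1) j (ρ.time i) ↔
      ρ.time i - ρ.time j ∉ I.1.toSet := fun j => TPTL1.sat_outside (fun _ => Iff.rfl) _
    simp only [MTL.toTPTL1, TPTL1.Sat, MTL.Sat, h1, h2, hout, and_assoc, true_and, ← not_and_or]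
    -- Since is until on the reversed order; positions being finite, that order is well-founded too.
    have := not_until_iff (α := (ρ.Pos)ᵒᵈ) (fun j => MTL.Sat ρ φ (OrderDual.ofDual j))
      (fun j => MTL.Sat ρ ψ (OrderDual.ofDual j) ∧
        ρ.time i - ρ.time (OrderDual.ofDual j) ∈ I.1.toSet) (OrderDual.toDual i)
    simp only [and_assoc] at this
    refine Iff.trans ?_ (this.trans ?_)
    · refine or_congr Iff.rfl (exists_congr fun j => and_congr Iff.rfl (and_congr Iff.rfl
        (and_congr Iff.rfl ?_)))
      exact forall_congr' fun k => forall_comm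
    · refine not_congr (exists_congr fun j => and_congr Iff.rfl (and_congr Iff.rfl
        (and_congr Iff.rfl ?_)))
      exact forall_congr' fun k => forall_comm

/-! ### Adjacency in the scopes of the translation. -/

/-- Every modality freezes `x` on the spot, so no constraint escapes to an enclosing quantifier and
scopes can be checked one modality at a time. -/
theorem MTL.outerIntervals_toTPTL1 {S : Type*} (φ : MTL S) :
    φ.toTPTL1.1.outerIntervals = ∅ ∧ φ.toTPTL1.2.outerIntervals = ∅ := by
  induction φ <;> simp_all [MTL.toTPTL1, TPTL1.outerIntervals]

theorem IntInterval.lo_ne_top (I : IntInterval) : I.lo ≠ ⊤ := by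
  intro h
  obtain ⟨t, h1 | h1, -⟩ := I.nonempty
  · simp [h] at h1
  · exact EReal.coe_ne_top t (h1.2.symm.trans h)

theorem IntInterval.hi_ne_bot (I : IntInterval) : I.hi ≠ ⊥ := by
  intro h
  obtain ⟨t, -, h1 | h1⟩ := I.nonempty
  · simp [h] at h1
  · exact EReal.coe_ne_bot t (h1.2.trans h)

theorem IsNatEndpoint.nonneg {e : EReal} (h : IsNatEndpoint e) : 0 ≤ e := by
  rcases h with rfl | ⟨n, rfl⟩
  · exact le_top
  · exact EReal.coe_nonneg.2 n.cast_nonneg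

/-- `J` is one of the two rays that form the complement of `I`. -/
def IntInterval.IsComplRay (I J : IntInterval) : Prop :=
  (J.lo = ⊥ ∧ J.hi = I.lo) ∨ (J.lo = I.hi ∧ J.hi = ⊤)

theorem IntInterval.posNonAdjacent_reflect {I J : IntInterval} (h : NegNonAdjacent I J) :
    PosNonAdjacent I.reflect J.reflect := by
  refine ⟨fun h1 => ?_, fun h1 => ?_⟩
  · exact EReal.neg_le.1 (by simpa using h.2 (neg_injective h1))
  · exact EReal.neg_le.1 (by simpa using h.1 (neg_injective h1))

theorem IntInterval.negNonAdjacent_reflect {I J : IntInterval} (h : PosNonAdjacent I J) :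
    NegNonAdjacent I.reflect J.reflect := by
  refine ⟨fun h1 => ?_, fun h1 => ?_⟩
  · exact EReal.neg_nonneg.2 (h.2 (neg_injective h1))
  · exact EReal.neg_nonneg.2 (h.1 (neg_injective h1))

theorem NatInterval.negNonAdjacent_self (I : NatInterval) :
    IntInterval.NegNonAdjacent I.1 I.1 :=
  ⟨fun _ => I.2.2.nonneg, fun _ => I.2.1.nonneg⟩

theorem NatInterval.posNonAdjacent_self (I : NatInterval) (h : ¬ I.1.IsPunctual) :
    IntInterval.PosNonAdjacent I.1 I.1 :=
  ⟨fun h1 => (h h1.symm).elim, fun h1 => (h h1).elim⟩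

/-- The rays can share an end point only if `I` is punctual, and the shared point is then
nonnegative, which the negative condition allows. -/
theorem NatInterval.negNonAdjacent_compl (I : NatInterval) {J J' : IntInterval}
    (h : I.1.IsComplRay J) (h' : I.1.IsComplRay J') : IntInterval.NegNonAdjacent J J' := by
  have h1 := J.lo_ne_top
  have h2 := J'.lo_ne_top
  have h3 := J.hi_ne_bot
  have h4 := J'.hi_ne_bot
  have h5 := I.2.1.nonneg
  have h6 := I.2.2.nonneg
  unfold IntInterval.NegNonAdjacent
  rcases h with ⟨a, b⟩ | ⟨a, b⟩ <;> rcases h' with ⟨c, d⟩ | ⟨c, d⟩ <;> grind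

/-- The rays end at `I.lo` and start at `I.hi`, which differ; the remaining coincidences would need
an infinite end point on the wrong side. -/
theorem NatInterval.posNonAdjacent_compl (I : NatInterval) (hI : ¬ I.1.IsPunctual)
    {J J' : IntInterval} (h : I.1.IsComplRay J) (h' : I.1.IsComplRay J') :
    IntInterval.PosNonAdjacent J J' := by
  have h1 := J.lo_ne_top
  have h2 := J'.lo_ne_top
  have h3 := J.hi_ne_bot
  have h4 := J'.hi_ne_bot
  have h5 : (⊥ : EReal) ≠ ⊤ := bot_ne_top
  unfold IntInterval.IsPunctual at hI
  unfold IntInterval.PosNonAdjacent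
  rcases h with ⟨a, b⟩ | ⟨a, b⟩ <;> rcases h' with ⟨c, d⟩ | ⟨c, d⟩ <;> grind

theorem TPTL1.outerIntervals_outside_constr {S : Type*} (I J : IntInterval)
    (h : J ∈ (TPTL1.outside (S := S) .constr I).outerIntervals) : I.IsComplRay J := by
  unfold TPTL1.outside TPTL1.constrOrFalse at h
  rcases h with h | h <;> split_ifs at h
  · rw [show J = _ from h]; exact Or.inl ⟨rfl, rfl⟩
  · exact h.elim
  · rw [show J = _ from h]; exact Or.inr ⟨rfl, rfl⟩
  · exact h.elim

theorem TPTL1.outerIntervals_outside_constrRev {S : Type*} (I J : IntInterval)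
    (h : J ∈ (TPTL1.outside (S := S) .constrRev I).outerIntervals) :
    ∃ J₀, I.IsComplRay J₀ ∧ J = J₀.reflect := by
  unfold TPTL1.outside TPTL1.constrOrFalse at h
  rcases h with h | h <;> split_ifs at h
  · exact ⟨_, Or.inl ⟨rfl, rfl⟩, h⟩
  · exact h.elim
  · exact ⟨_, Or.inr ⟨rfl, rfl⟩, h⟩
  · exact h.elim

theorem TPTL1.scopesSatisfy_outside {S : Type*} (R : IntInterval → IntInterval → Prop)
    {c : IntInterval → TPTL1 S} (hc : ∀ J, (c J).ScopesSatisfy R) (I : IntInterval) :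
    (TPTL1.outside c I).ScopesSatisfy R := by
  unfold TPTL1.outside TPTL1.constrOrFalse
  constructor <;> split_ifs <;> first | exact hc _ | trivial

/-- The scopes of the translation of an until modality satisfy `R` if `R` relates its interval and
the rays forming the complement. -/
theorem MTL.scopesSatisfy_untl {S : Type*} {R : IntInterval → IntInterval → Prop}
    {I : NatInterval} {φ ψ : MTL S} (hI : R I.1 I.1)
    (hc : ∀ J J', I.1.IsComplRay J → I.1.IsComplRay J' → R J J')
    (hφ : φ.toTPTL1.1.ScopesSatisfy R ∧ φ.toTPTL1.2.ScopesSatisfy R)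
    (hψ : ψ.toTPTL1.1.ScopesSatisfy R ∧ ψ.toTPTL1.2.ScopesSatisfy R) :
    (MTL.untl I φ ψ).toTPTL1.1.ScopesSatisfy R ∧ (MTL.untl I φ ψ).toTPTL1.2.ScopesSatisfy R := by
  have ho := TPTL1.scopesSatisfy_outside (S := S) R (c := .constr) (fun _ => trivial) I.1
  have e1 := φ.outerIntervals_toTPTL1
  have e2 := ψ.outerIntervals_toTPTL1
  have hr := TPTL1.outerIntervals_outside_constr (S := S) I.1
  simp only [MTL.toTPTL1, TPTL1.ScopesSatisfy, TPTL1.outerIntervals, e1, e2, hφ, hψ, ho,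
    Set.empty_union, Set.union_self, and_self, and_true]
  refine ⟨?_, fun J hJ J' hJ' => hc J J' (hr J hJ) (hr J' hJ')⟩
  rintro J rfl J' rfl
  exact hI

theorem MTL.scopesSatisfy_snce {S : Type*} {R : IntInterval → IntInterval → Prop}
    {I : NatInterval} {φ ψ : MTL S} (hI : R I.1.reflect I.1.reflect)
    (hc : ∀ J J', I.1.IsComplRay J → I.1.IsComplRay J' → R J.reflect J'.reflect)
    (hφ : φ.toTPTL1.1.ScopesSatisfy R ∧ φ.toTPTL1.2.ScopesSatisfy R)
    (hψ : ψ.toTPTL1.1.ScopesSatisfy R ∧ ψ.toTPTL1.2.ScopesSatisfy R) :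
    (MTL.snce I φ ψ).toTPTL1.1.ScopesSatisfy R ∧ (MTL.snce I φ ψ).toTPTL1.2.ScopesSatisfy R := by
  have ho := TPTL1.scopesSatisfy_outside (S := S) R (c := .constrRev) (fun _ => trivial) I.1
  have e1 := φ.outerIntervals_toTPTL1
  have e2 := ψ.outerIntervals_toTPTL1
  have hr := TPTL1.outerIntervals_outside_constrRev (S := S) I.1
  simp only [MTL.toTPTL1, TPTL1.ScopesSatisfy, TPTL1.outerIntervals, e1, e2, hφ, hψ, ho,
    Set.empty_union, Set.union_self, and_self, and_true]
  refine ⟨?_, fun J hJ J' hJ' => ?_⟩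
  · rintro J rfl J' rfl
    exact hI
  · obtain ⟨K, hK, rfl⟩ := hr J hJ
    obtain ⟨K', hK', rfl⟩ := hr J' hJ'
    exact hc K K' hK hK'

theorem MTL.isNANeg_toTPTL1 {S : Type*} (φ : MTL S) (h : φ.SinceNonPunctual) :
    φ.toTPTL1.1.IsNANeg ∧ φ.toTPTL1.2.IsNANeg := by
  induction φ with
  | atom a => exact ⟨trivial, trivial⟩
  | tru => exact ⟨trivial, trivial⟩
  | and φ ψ h1 h2 => exact ⟨⟨(h1 h.1).1, (h2 h.2).1⟩, ⟨(h1 h.1).2, (h2 h.2).2⟩⟩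
  | neg φ h1 => exact ⟨(h1 h).2, (h1 h).1⟩
  | untl I φ ψ h1 h2 =>
    exact MTL.scopesSatisfy_untl I.negNonAdjacent_self
      (fun _ _ hJ hJ' => I.negNonAdjacent_compl hJ hJ') (h1 h.1) (h2 h.2)
  | snce I φ ψ h1 h2 =>
    exact MTL.scopesSatisfy_snce
      (IntInterval.negNonAdjacent_reflect (I.posNonAdjacent_self h.1))
      (fun _ _ hJ hJ' => IntInterval.negNonAdjacent_reflect (I.posNonAdjacent_compl h.1 hJ hJ'))
      (h1 h.2.1) (h2 h.2.2)

theorem MTL.isNAPos_toTPTL1 {S : Type*} (φ : MTL S) (h : φ.UntilNonPunctual) :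
    φ.toTPTL1.1.IsNAPos ∧ φ.toTPTL1.2.IsNAPos := by
  induction φ with
  | atom a => exact ⟨trivial, trivial⟩
  | tru => exact ⟨trivial, trivial⟩
  | and φ ψ h1 h2 => exact ⟨⟨(h1 h.1).1, (h2 h.2).1⟩, ⟨(h1 h.1).2, (h2 h.2).2⟩⟩
  | neg φ h1 => exact ⟨(h1 h).2, (h1 h).1⟩
  | untl I φ ψ h1 h2 =>
    exact MTL.scopesSatisfy_untl (I.posNonAdjacent_self h.1)
      (fun _ _ hJ hJ' => I.posNonAdjacent_compl h.1 hJ hJ') (h1 h.2.1) (h2 h.2.2)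
  | snce I φ ψ h1 h2 =>
    exact MTL.scopesSatisfy_snce
      (IntInterval.posNonAdjacent_reflect I.negNonAdjacent_self)
      (fun _ _ hJ hJ' => IntInterval.posNonAdjacent_reflect (I.negNonAdjacent_compl hJ hJ'))
      (h1 h.1) (h2 h.2)

/-- Every partially punctual MTL formula is equivalent to a partially adjacent `1-TPTL` formula. -/
theorem MTL.IsPMTL.exists_isPA {S : Type*} {φ : MTL S} (h : φ.IsPMTL) :
    ∃ θ : TPTL1 S, θ.IsPA ∧ θ.language = φ.language :=
  ⟨φ.toTPTL1.1, h.elim (fun h => Or.inr (φ.isNANeg_toTPTL1 h).1)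
    (fun h => Or.inl (φ.isNAPos_toTPTL1 h).1),
    Set.ext fun ρ => (φ.sat_toTPTL1 ρ 0 0).1⟩

/-! ### The back-and-forth game on time stamps. -/

/-- Time stamps indexed by `ℤ` that increase and in which three steps take at least `1/2` and less
than `1`. -/
structure TameTimes (T : ℤ → ℝ) : Prop where
  lt_succ : ∀ p, T p < T (p + 1)
  add_three_lt : ∀ p, T (p + 3) < T p + 1
  le_add_three : ∀ p, T p + 1 / 2 ≤ T (p + 3)

namespace TameTimes

variable {T : ℤ → ℝ}

theorem strictMono (h : TameTimes T) : StrictMono T := strictMono_int_of_lt_succ h.lt_succ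

theorem add_three_mul_le (h : TameTimes T) (p : ℤ) (s : ℕ) :
    T p + s / 2 ≤ T (p + 3 * s) := by
  induction s with
  | zero => simp
  | succ s ih =>
    have := h.le_add_three (p + 3 * s)
    rw [show p + 3 * ((s + 1 : ℕ) : ℤ) = p + 3 * s + 3 by push_cast; ring]
    push_cast
    linarith

theorem add_le_of_le (h : TameTimes T) {p q : ℤ} (s : ℕ) (hpq : p + 3 * s ≤ q) :
    T p + s / 2 ≤ T q :=
  (h.add_three_mul_le p s).trans (h.strictMono.monotone hpq)

/-- Among the positions congruent to `p` modulo `3`, some position is at a prescribed integral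
distance from `i`, up to rounding. -/
theorem exists_floor_eq (h : TameTimes T) {i p : ℤ} (hip : i < p) (hpi : p ≤ i + 3) (f : ℕ) :
    ∃ s : ℕ, s ≤ 2 * f ∧ ⌊T (p + 3 * s) - T i⌋ = f := by
  have hex : ∃ s : ℕ, (f : ℝ) ≤ T (p + 3 * s) - T i := by
    refine ⟨2 * f, ?_⟩
    have h1 := h.add_three_mul_le p (2 * f)
    have h2 := h.strictMono hip
    push_cast at h1 ⊢
    linarith
  classical
  -- The least `s` reaching distance `f` overshoots by less than one, since its predecessor was
  -- below `f` and three positions take less than one unit.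
  refine ⟨Nat.find hex, Nat.find_min' hex ?_, ?_⟩
  · have h1 := h.add_three_mul_le p (2 * f)
    have h2 := h.strictMono hip
    push_cast at h1 ⊢
    linarith
  · refine Int.floor_eq_iff.2 ⟨by exact_mod_cast Nat.find_spec hex, ?_⟩
    push_cast
    rcases hs : Nat.find hex with _ | s
    · have h1 := h.strictMono.monotone hpi
      have h2 := h.add_three_lt i
      have h3 : (0 : ℝ) ≤ f := f.cast_nonneg
      simp only [Nat.cast_zero, mul_zero, add_zero]
      linarith
    · have h1 := Nat.find_min hex (m := s) (by omega)
      have h2 := h.add_three_lt (p + 3 * s)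
      rw [show p + 3 * ((s + 1 : ℕ) : ℤ) = p + 3 * s + 3 by push_cast; ring]
      push Not at h1
      linarith

/-- Reading time backwards from `L` turns moves to the left into moves to the right. -/
theorem reverse (h : TameTimes T) (L : ℤ) : TameTimes fun p => -T (L - p) where
  lt_succ p := by
    have := h.lt_succ (L - (p + 1))
    rw [show L - (p + 1) + 1 = L - p by ring] at this
    linarith
  add_three_lt p := by
    have := h.add_three_lt (L - (p + 3))
    rw [show L - (p + 3) + 3 = L - p by ring] at this
    linarith
  le_add_three p := by
    have := h.le_add_three (L - (p + 3))
    rw [show L - (p + 3) + 3 = L - p by ring] at this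
    linarith

end TameTimes

/-- The positions in `[0, L]` at distance at least `d` from both ends. -/
def Inner (L d p : ℤ) : Prop := d ≤ p ∧ p ≤ L - d

/-- Two positions agree up to margin `d` if they are equal, or both far from the ends of `[0, L]`
and congruent modulo `3`. -/
def Agree (L d p p' : ℤ) : Prop :=
  p = p' ∨ (Inner L d p ∧ Inner L d p' ∧ (3 : ℤ) ∣ p - p')

theorem Agree.symm {L d p p' : ℤ} (h : Agree L d p p') : Agree L d p' p := by
  rcases h with rfl | ⟨h1, h2, h3⟩
  · exact Or.inl rfl
  · exact Or.inr ⟨h2, h1, (dvd_sub_comm).1 h3⟩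

theorem Inner.reverse {L d p : ℤ} (h : Inner L d p) : Inner L d (L - p) := by
  unfold Inner at *; omega

theorem Agree.reverse {L d p p' : ℤ} (h : Agree L d p p') : Agree L d (L - p) (L - p') := by
  rcases h with rfl | ⟨h1, h2, h3⟩
  · exact Or.inl rfl
  · exact Or.inr ⟨h1.reverse, h2.reverse, by omega⟩

/-- Two distances look the same to intervals with integral end points up to `K`, provided that they
are not integers. -/
def SameDist (K : ℕ) (d d' : ℝ) : Prop := ⌊d⌋ = ⌊d'⌋ ∨ ((K : ℝ) < d ∧ (K : ℝ) < d')

/-- A move to the right in one sequence of time stamps can be answered in another sequence that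
differs from it in a single position far from the ends. -/
theorem TameTimes.forth {T T' : ℤ → ℝ} (hT : TameTimes T) (hT' : TameTimes T') {K : ℕ}
    {L d m : ℤ} (hd : 0 ≤ d) (hm : Inner L (d + 2 * (6 * K + 12)) m)
    (heq : ∀ p, p ≠ m → T p = T' p) {i i' j : ℤ}
    (hi : Agree L (d + (6 * K + 12)) i i') (hij : i < j) (hjL : j ≤ L) :
    ∃ j', i' < j' ∧ j' ≤ L ∧ Agree L d j j' ∧ SameDist K (T j - T i) (T' j' - T' i') ∧
      ∀ k', i' < k' → k' < j' → ∃ k, i < k ∧ k < j ∧ Agree L d k k' := by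
  -- Three positions take at least `1/2`, so `6K + 3` of them take at least `K + 1/2`.
  have far : ∀ {U : ℤ → ℝ}, TameTimes U → ∀ {p q : ℤ}, p + (6 * K + 3) ≤ q →
      (K : ℝ) < U q - U p := by
    intro U hU p q hpq
    have := hU.add_le_of_le (2 * K + 1) (p := p) (q := q) (by push_cast; omega)
    push_cast at this
    linarith
  by_cases hsame : i = i' ∧ SameDist K (T j - T i) (T' j - T' i)
  · obtain ⟨rfl, hs⟩ := hsame
    exact ⟨j, hij, hjL, Or.inl rfl, hs, fun k h1 h2 => ⟨k, h1, h2, Or.inl rfl⟩⟩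
  -- If `i = i'` but answering `j` by itself fails, then `j` is near `i` and one of them is `m`; the
  -- double margin of `m` makes `i` inner.
  have hi' : Inner L (d + (6 * K + 12)) i ∧ Inner L (d + (6 * K + 12)) i' ∧ (3 : ℤ) ∣ i - i' := by
    rcases hi with rfl | hi
    · have hns : ¬ SameDist K (T j - T i) (T' j - T' i) := fun h => hsame ⟨rfl, h⟩
      have hnear : j < i + (6 * K + 3) := by
        by_contra hcon
        push Not at hcon
        exact hns (Or.inr ⟨far hT hcon, far hT' hcon⟩)
      have hmm : i = m ∨ j = m := by
        by_contra hcon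
        push Not at hcon
        exact hns (Or.inl (by rw [heq i hcon.1, heq j hcon.2]))
      have hin : Inner L (d + (6 * K + 12)) i := by
        unfold Inner at *
        omega
      exact ⟨hin, hin, by simp⟩
    · exact hi
  obtain ⟨h1, h2, h3⟩ := hi'
  unfold Inner at h1 h2 hm
  -- A short move is copied by translation: both distances have floor 0.
  rcases le_or_gt j (i + 3) with hj3 | hj3
  · refine ⟨i' + (j - i), by omega, by omega, Or.inr ⟨?_, ?_, by omega⟩, Or.inl ?_, ?_⟩
    · unfold Inner; omega
    · unfold Inner; omega
    · have key : ∀ {U : ℤ → ℝ}, TameTimes U → ∀ {p q : ℤ}, p < q → q ≤ p + 3 →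
          ⌊U q - U p⌋ = 0 := by
        intro U hU p q hpq hqp
        have e1 := hU.strictMono hpq
        have e2 := hU.strictMono.monotone hqp
        have e3 := hU.add_three_lt p
        rw [Int.floor_eq_zero_iff]
        exact ⟨by linarith, by linarith⟩
      rw [key hT hij hj3, key hT' (by omega) (by omega)]
    · intro k' hk1 hk2
      exact ⟨k' - i' + i, by omega, by omega,
        Or.inr ⟨by unfold Inner; omega, by unfold Inner; omega, by omega⟩⟩
  -- For a long move, `i + 1`, `i + 2`, `i + 3` lie strictly between `i` and `j` and represent all
  -- residues, so every inner `k'` has a partner.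
  have hcov : ∀ k', Inner L d k' → ∃ k, i < k ∧ k < j ∧ Agree L d k k' := by
    intro k' hk'
    refine ⟨i + 1 + (k' - i - 1) % 3, by omega, by omega,
      Or.inr ⟨by unfold Inner; omega, hk', by omega⟩⟩
  by_cases hjin : Inner L d j
  · have hans : ∀ s : ℕ, s ≤ 2 * K + 2 →
        SameDist K (T j - T i) (T' (i' + 1 + (j - i' - 1) % 3 + 3 * s) - T' i') →
        ∃ j', i' < j' ∧ j' ≤ L ∧ Agree L d j j' ∧ SameDist K (T j - T i) (T' j' - T' i') ∧
          ∀ k', i' < k' → k' < j' → ∃ k, i < k ∧ k < j ∧ Agree L d k k' := by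
      intro s hs hsd
      refine ⟨_, by omega, by omega, Or.inr ⟨hjin, by unfold Inner; omega, by omega⟩, hsd, ?_⟩
      intro k' hk1 hk2
      exact hcov k' (by unfold Inner; omega)
    rcases lt_or_ge (K : ℝ) (T j - T i) with hK | hK
    · refine hans (2 * K + 2) le_rfl (Or.inr ⟨hK, far hT' ?_⟩)
      push_cast
      omega
    · have hnn : 0 ≤ T j - T i := sub_nonneg.2 (hT.strictMono hij).le
      obtain ⟨f, hf⟩ := Int.eq_ofNat_of_zero_le (Int.floor_nonneg.2 hnn)
      have hfK : f ≤ K := by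
        have : ((f : ℤ) : ℝ) ≤ T j - T i := hf ▸ Int.floor_le _
        exact_mod_cast this.trans hK
      obtain ⟨s, hs, hfl⟩ := hT'.exists_floor_eq (i := i') (p := i' + 1 + (j - i' - 1) % 3)
        (by omega) (by omega) f
      exact hans s (by omega) (Or.inl (by rw [hf, hfl]))
  · unfold Inner at hjin
    -- Here `j` lies near the right end, more than `K` from both `i` and `i'`, so it answers itself.
    refine ⟨j, by omega, hjL, Or.inl rfl, Or.inr ⟨far hT (by omega), far hT' (by omega)⟩, ?_⟩
    intro k' hk1 hk2
    by_cases hk : Inner L d k'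
    · exact hcov k' hk
    · unfold Inner at hk
      exact ⟨k', by omega, hk2, Or.inl rfl⟩

/-- A move to the left in one sequence of time stamps can be answered in another sequence that
differs from it in a single position far from the ends. -/
theorem TameTimes.back {T T' : ℤ → ℝ} (hT : TameTimes T) (hT' : TameTimes T') {K : ℕ}
    {L d m : ℤ} (hd : 0 ≤ d) (hm : Inner L (d + 2 * (6 * K + 12)) m)
    (heq : ∀ p, p ≠ m → T p = T' p) {i i' j : ℤ}
    (hi : Agree L (d + (6 * K + 12)) i i') (hij : j < i) (hj : 0 ≤ j) :
    ∃ j', j' < i' ∧ 0 ≤ j' ∧ Agree L d j j' ∧ SameDist K (T i - T j) (T' i' - T' j') ∧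
      ∀ k', j' < k' → k' < i' → ∃ k, j < k ∧ k < i ∧ Agree L d k k' := by
  obtain ⟨j', h1, h2, h3, h4, h5⟩ := (hT.reverse L).forth (hT'.reverse L) hd hm.reverse
    (fun p hp => by rw [heq (L - p) (by omega)]) hi.reverse (j := L - j) (by omega) (by omega)
  refine ⟨L - j', by omega, by omega, ?_, ?_, ?_⟩
  · simpa using h3.reverse
  · convert h4 using 1
    · simp only [sub_sub_cancel]; ring
    · simp only [sub_sub_cancel]; ring
  · intro k' hk1 hk2
    obtain ⟨k, e1, e2, e3⟩ := h5 (L - k') (by omega) (by omega)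
    exact ⟨L - k, by omega, by omega, by simpa using e3.reverse⟩

/-! ### Indistinguishable words -/

/-- The nesting depth of the modalities. -/
def MTL.depth {S : Type*} : MTL S → ℕ
  | .atom _ => 0
  | .tru => 0
  | .and φ ψ => max φ.depth ψ.depth
  | .neg φ => φ.depth
  | .untl _ φ ψ => max φ.depth ψ.depth + 1
  | .snce _ φ ψ => max φ.depth ψ.depth + 1

/-- All numbers beyond `K` agree on membership in the interval. -/
def IntInterval.ConstBeyond (I : IntInterval) (K : ℕ) : Prop :=
  ∀ d d' : ℝ, (K : ℝ) < d → (K : ℝ) < d' → d ∈ I.toSet → d' ∈ I.toSet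

/-- No interval in the formula separates numbers beyond `K`. -/
def MTL.ConstBeyond {S : Type*} (K : ℕ) : MTL S → Prop
  | .atom _ => True
  | .tru => True
  | .and φ ψ => φ.ConstBeyond K ∧ ψ.ConstBeyond K
  | .neg φ => φ.ConstBeyond K
  | .untl I φ ψ => I.1.ConstBeyond K ∧ φ.ConstBeyond K ∧ ψ.ConstBeyond K
  | .snce I φ ψ => I.1.ConstBeyond K ∧ φ.ConstBeyond K ∧ ψ.ConstBeyond K

theorem NatInterval.exists_constBeyond (I : NatInterval) : ∃ K, I.1.ConstBeyond K := by
  obtain ⟨I, hlo, hhi⟩ := I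
  obtain ⟨n, hn⟩ : ∃ n : ℕ, I.lo = ((n : ℝ) : EReal) := by
    rcases hlo with h | h
    · exact (I.lo_ne_top h).elim
    · exact h
  rcases hhi with h | ⟨k, hk⟩
  · refine ⟨n, fun d d' h1 h2 _ => ⟨Or.inl ?_, Or.inl ?_⟩⟩
    · rw [hn]; exact EReal.coe_lt_coe_iff.2 h2
    · rw [h]; exact EReal.coe_lt_top _
  · refine ⟨k, fun d d' h1 h2 h3 => ?_⟩
    rcases h3.2 with h3 | ⟨-, h3⟩
    · rw [hk, EReal.coe_lt_coe_iff] at h3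
      linarith
    · rw [hk, EReal.coe_eq_coe_iff] at h3
      linarith

theorem IntInterval.ConstBeyond.mono {I : IntInterval} {K K' : ℕ} (h : I.ConstBeyond K)
    (hK : K ≤ K') : I.ConstBeyond K' := by
  have : (K : ℝ) ≤ K' := Nat.cast_le.2 hK
  exact fun d d' h1 h2 => h d d' (this.trans_lt h1) (this.trans_lt h2)

theorem MTL.ConstBeyond.mono {S : Type*} {φ : MTL S} {K K' : ℕ} (h : φ.ConstBeyond K)
    (hK : K ≤ K') : φ.ConstBeyond K' := by
  induction φ with
  | atom a => trivial
  | tru => trivial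
  | and φ ψ h1 h2 => exact ⟨h1 h.1, h2 h.2⟩
  | neg φ h1 => exact h1 h
  | untl I φ ψ h1 h2 => exact ⟨h.1.mono hK, h1 h.2.1, h2 h.2.2⟩
  | snce I φ ψ h1 h2 => exact ⟨h.1.mono hK, h1 h.2.1, h2 h.2.2⟩

theorem MTL.exists_constBeyond {S : Type*} (φ : MTL S) : ∃ K, φ.ConstBeyond K := by
  induction φ with
  | atom a => exact ⟨0, trivial⟩
  | tru => exact ⟨0, trivial⟩
  | and φ ψ h1 h2 =>
    obtain ⟨k1, h1⟩ := h1
    obtain ⟨k2, h2⟩ := h2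
    exact ⟨max k1 k2, h1.mono (le_max_left _ _), h2.mono (le_max_right _ _)⟩
  | neg φ h => exact h
  | untl I φ ψ h1 h2 | snce I φ ψ h1 h2 =>
    obtain ⟨k1, h1⟩ := h1
    obtain ⟨k2, h2⟩ := h2
    obtain ⟨k3, h3⟩ := I.exists_constBeyond
    exact ⟨max k3 (max k1 k2), h3.mono (le_max_left _ _),
      h1.mono ((le_max_left _ _).trans (le_max_right _ _)),
      h2.mono ((le_max_right _ _).trans (le_max_right _ _))⟩

/-- Numbers with the same floor compare in the same way with integers from below. -/
theorem lt_intCast_of_floor_eq {d d' : ℝ} (hf : ⌊d⌋ = ⌊d'⌋) {n : ℤ} (h : d < n) : d' < n :=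
  Int.floor_lt.1 (hf ▸ Int.floor_lt.2 h)

theorem intCast_lt_of_floor_eq {d d' : ℝ} (hf : ⌊d⌋ = ⌊d'⌋) (hd' : ∀ z : ℤ, d' ≠ z) {n : ℤ}
    (h : n < d) : n < d' :=
  lt_of_le_of_ne (Int.le_floor.1 (hf ▸ Int.le_floor.2 h.le)) (hd' n).symm

/-- Non-integral numbers with equal floors lie in the same open unit interval, which no integral end
point can split. -/
theorem IntInterval.mem_of_floor_eq (I : IntInterval) {d d' : ℝ} (hf : ⌊d⌋ = ⌊d'⌋)
    (hd : ∀ z : ℤ, d ≠ z) (hd' : ∀ z : ℤ, d' ≠ z) (h : d ∈ I.toSet) : d' ∈ I.toSet := by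
  obtain ⟨h1, h2⟩ := h
  constructor
  · rcases I.lo_int with e | e | ⟨n, e⟩ <;> rw [e] at h1 ⊢
    · exact Or.inl (EReal.bot_lt_coe _)
    · rcases h1 with h1 | ⟨-, h1⟩
      · exact (not_top_lt h1).elim
      · exact (EReal.coe_ne_top _ h1.symm).elim
    · rw [EReal.coe_lt_coe_iff, EReal.coe_eq_coe_iff] at h1
      rcases h1 with h1 | ⟨-, h1⟩
      · exact Or.inl (EReal.coe_lt_coe_iff.2 (intCast_lt_of_floor_eq hf hd' h1))
      · exact (hd n h1.symm).elim
  · rcases I.hi_int with e | e | ⟨n, e⟩ <;> rw [e] at h2 ⊢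
    · rcases h2 with h2 | ⟨-, h2⟩
      · exact (not_lt_bot h2).elim
      · exact (EReal.coe_ne_bot _ h2).elim
    · exact Or.inl (EReal.coe_lt_top _)
    · rw [EReal.coe_lt_coe_iff, EReal.coe_eq_coe_iff] at h2
      rcases h2 with h2 | ⟨-, h2⟩
      · exact Or.inl (EReal.coe_lt_coe_iff.2 (lt_intCast_of_floor_eq hf h2))
      · exact (hd n h2).elim

theorem SameDist.mem {K : ℕ} {d d' : ℝ} (h : SameDist K d d') {I : IntInterval}
    (hI : I.ConstBeyond K) (hd : ∀ z : ℤ, d ≠ z) (hd' : ∀ z : ℤ, d' ≠ z) (hm : d ∈ I.toSet) :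
    d' ∈ I.toSet := by
  rcases h with h | ⟨h1, h2⟩
  · exact I.mem_of_floor_eq h hd hd' hm
  · exact hI d d' h1 h2 hm

/-- The timed word with `L + 1` positions, labels `lab` and time stamps `T`. -/
def TimedWord.ofInt {S : Type*} (L : ℕ) (lab : ℤ → S) (T : ℤ → ℝ) (hT : TameTimes T)
    (h0 : T 0 = 0) : TimedWord S where
  last := L
  label i := {lab (i : ℕ)}
  label_nonempty _ := Set.singleton_nonempty _
  time i := T (i : ℕ)
  time_zero := by simpa using h0
  time_mono _ _ h := hT.strictMono.monotone (by exact_mod_cast h)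

/-- Distinct positions in `[0, L]` do not have an integral distance. -/
def NonIntegral (L : ℤ) (T : ℤ → ℝ) : Prop :=
  ∀ p q : ℤ, 0 ≤ p → p < q → q ≤ L → ∀ z : ℤ, T q - T p ≠ z

/-- Each modality costs one margin of `6K + 12`. The hypothesis on `m` keeps one margin in reserve,
so that a position close to `m` always counts as inner. -/
theorem MTL.sat_iff_of_agree {S : Type*} {L : ℕ} {lab : ℤ → S} (hlab : ∀ p, lab (p + 3) = lab p)
    {K : ℕ} {m : ℤ} (φ : MTL S) (hφ : φ.ConstBeyond K) (n : ℕ) (hn : φ.depth ≤ n)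
    (hm : Inner L ((n + 1) * (6 * K + 12)) m) {T T' : ℤ → ℝ} (hT : TameTimes T)
    (hT' : TameTimes T') (h0 : T 0 = 0) (h0' : T' 0 = 0) (hnT : NonIntegral L T)
    (hnT' : NonIntegral L T') (heq : ∀ p, p ≠ m → T p = T' p) (i i' : Fin (L + 1))
    (hi : Agree L (n * (6 * K + 12)) (i : ℕ) (i' : ℕ)) :
    MTL.Sat (TimedWord.ofInt L lab T hT h0) φ i ↔
      MTL.Sat (TimedWord.ofInt L lab T' hT' h0') φ i' := by
  have hmod : ∀ p q : ℤ, (3 : ℤ) ∣ p - q → lab p = lab q := by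
    have hper : Function.Periodic lab 3 := hlab
    rintro p q ⟨z, hz⟩
    rw [show p = q + z * 3 by linarith]
    exact hper.int_mul z q
  have dvd_of : ∀ {d p p' : ℤ}, Agree L d p p' → (3 : ℤ) ∣ p - p' := by
    rintro d p p' (rfl | ⟨-, -, h⟩)
    · simp
    · exact h
  induction φ generalizing n T T' i i' with
  | atom a =>
    have : lab (i : ℕ) = lab (i' : ℕ) := hmod _ _ (dvd_of hi)
    simp only [MTL.Sat, TimedWord.ofInt, this]
  | tru => exact Iff.rfl
  | and φ ψ h1 h2 =>
    simp only [MTL.depth, max_le_iff] at hn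
    exact and_congr (h1 hφ.1 n hn.1 hm hT hT' h0 h0' hnT hnT' heq i i' hi)
      (h2 hφ.2 n hn.2 hm hT hT' h0 h0' hnT hnT' heq i i' hi)
  | neg φ h => exact not_congr (h hφ n hn hm hT hT' h0 h0' hnT hnT' heq i i' hi)
  | untl I φ ψ h1 h2 =>
    obtain ⟨hI, hφ, hψ⟩ := hφ
    simp only [MTL.depth] at hn
    obtain ⟨n, rfl⟩ : ∃ k, n = k + 1 := ⟨n - 1, by omega⟩
    have hd : (0 : ℤ) ≤ n * (6 * K + 12) := by positivity
    have hm' : Inner L (n * (6 * K + 12) + 2 * (6 * K + 12)) m := by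
      convert hm using 1; push_cast; ring
    have hm1 : Inner L ((n + 1) * (6 * K + 12)) m := by
      push_cast at hm
      unfold Inner at *
      constructor <;> nlinarith
    -- One implication suffices: the hypotheses are symmetric in `T` and `T'`.
    have main : ∀ {T T' : ℤ → ℝ} (hT : TameTimes T) (hT' : TameTimes T') (h0 : T 0 = 0)
        (h0' : T' 0 = 0), NonIntegral L T → NonIntegral L T' → (∀ p, p ≠ m → T p = T' p) →
        ∀ i i' : Fin (L + 1), Agree L ((n + 1 : ℕ) * (6 * K + 12)) (i : ℕ) (i' : ℕ) →
        MTL.Sat (TimedWord.ofInt L lab T hT h0) (.untl I φ ψ) i →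
        MTL.Sat (TimedWord.ofInt L lab T' hT' h0') (.untl I φ ψ) i' := by
      clear hi i i' heq hnT hnT' h0 h0' hT hT' T T'
      intro T T' hT hT' h0 h0' hnT hnT' heq i i' hi hsat
      obtain ⟨j, hij, hj, hjI, hk⟩ := hsat
      change Fin (L + 1) at j
      have hij' : (i : ℕ) < (j : ℕ) := hij
      obtain ⟨l, g1, g2, g3, g4, g5⟩ := hT.forth hT' hd hm' heq
        (show Agree L (n * (6 * K + 12) + (6 * K + 12)) (i : ℕ) (i' : ℕ) by
          convert hi using 1; push_cast; ring)
        (j := (j : ℕ)) (by omega) (by omega)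
      obtain ⟨l, rfl⟩ := Int.eq_ofNat_of_zero_le (show 0 ≤ l by omega)
      have hl : l < L + 1 := by omega
      refine ⟨⟨l, hl⟩, ?_, ?_, ?_, ?_⟩
      · exact Fin.lt_def.2 (by exact_mod_cast g1)
      · exact (h2 hψ n (by omega) hm1 hT hT' h0 h0' hnT hnT' heq j ⟨l, hl⟩ g3).1 hj
      · exact g4.mem hI (hnT _ _ (by omega) (by omega) (by omega))
          (hnT' _ _ (by omega) g1 g2) hjI
      · intro k' hk1 hk2
        change Fin (L + 1) at k'
        have hk1' : (i' : ℕ) < (k' : ℕ) := hk1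
        have hk2' : (k' : ℕ) < l := hk2
        obtain ⟨k, f1, f2, f3⟩ := g5 (k' : ℕ) (by omega) (by omega)
        obtain ⟨k, rfl⟩ := Int.eq_ofNat_of_zero_le (show 0 ≤ k by omega)
        have hkL : k < L + 1 := by omega
        refine (h1 hφ n (by omega) hm1 hT hT' h0 h0' hnT hnT' heq ⟨k, hkL⟩ k' f3).1
          (hk ⟨k, hkL⟩ ?_ ?_)
        · exact Fin.lt_def.2 (by exact_mod_cast f1)
        · exact Fin.lt_def.2 (by exact_mod_cast f2)
    exact ⟨main hT hT' h0 h0' hnT hnT' heq i i' hi,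
      main hT' hT h0' h0 hnT' hnT (fun p hp => (heq p hp).symm) i' i hi.symm⟩
  | snce I φ ψ h1 h2 =>
    obtain ⟨hI, hφ, hψ⟩ := hφ
    simp only [MTL.depth] at hn
    obtain ⟨n, rfl⟩ : ∃ k, n = k + 1 := ⟨n - 1, by omega⟩
    have hd : (0 : ℤ) ≤ n * (6 * K + 12) := by positivity
    have hm' : Inner L (n * (6 * K + 12) + 2 * (6 * K + 12)) m := by
      convert hm using 1; push_cast; ring
    have hm1 : Inner L ((n + 1) * (6 * K + 12)) m := by
      push_cast at hm
      unfold Inner at *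
      constructor <;> nlinarith
    have main : ∀ {T T' : ℤ → ℝ} (hT : TameTimes T) (hT' : TameTimes T') (h0 : T 0 = 0)
        (h0' : T' 0 = 0), NonIntegral L T → NonIntegral L T' → (∀ p, p ≠ m → T p = T' p) →
        ∀ i i' : Fin (L + 1), Agree L ((n + 1 : ℕ) * (6 * K + 12)) (i : ℕ) (i' : ℕ) →
        MTL.Sat (TimedWord.ofInt L lab T hT h0) (.snce I φ ψ) i →
        MTL.Sat (TimedWord.ofInt L lab T' hT' h0') (.snce I φ ψ) i' := by
      clear hi i i' heq hnT hnT' h0 h0' hT hT' T T'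
      intro T T' hT hT' h0 h0' hnT hnT' heq i i' hi hsat
      obtain ⟨j, hij, hj, hjI, hk⟩ := hsat
      change Fin (L + 1) at j
      have hij' : (j : ℕ) < (i : ℕ) := hij
      obtain ⟨l, g1, g2, g3, g4, g5⟩ := hT.back hT' hd hm' heq
        (show Agree L (n * (6 * K + 12) + (6 * K + 12)) (i : ℕ) (i' : ℕ) by
          convert hi using 1; push_cast; ring)
        (j := (j : ℕ)) (by omega) (by omega)
      obtain ⟨l, rfl⟩ := Int.eq_ofNat_of_zero_le (show 0 ≤ l by omega)
      have hl : l < L + 1 := by omega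
      refine ⟨⟨l, hl⟩, ?_, ?_, ?_, ?_⟩
      · exact Fin.lt_def.2 (by exact_mod_cast g1)
      · exact (h2 hψ n (by omega) hm1 hT hT' h0 h0' hnT hnT' heq j ⟨l, hl⟩ g3).1 hj
      · exact g4.mem hI (hnT _ _ (by omega) (by omega) (by omega))
          (hnT' _ _ (by omega) g1 (by omega)) hjI
      · intro k' hk1 hk2
        change Fin (L + 1) at k'
        have hk1' : l < (k' : ℕ) := hk1
        have hk2' : (k' : ℕ) < (i' : ℕ) := hk2
        obtain ⟨k, f1, f2, f3⟩ := g5 (k' : ℕ) (by omega) (by omega)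
        obtain ⟨k, rfl⟩ := Int.eq_ofNat_of_zero_le (show 0 ≤ k by omega)
        have hkL : k < L + 1 := by omega
        refine (h1 hφ n (by omega) hm1 hT hT' h0 h0' hnT hnT' heq ⟨k, hkL⟩ k' f3).1
          (hk ⟨k, hkL⟩ ?_ ?_)
        · exact Fin.lt_def.2 (by exact_mod_cast f1)
        · exact Fin.lt_def.2 (by exact_mod_cast f2)
    exact ⟨main hT hT' h0 h0' hnT hnT' heq i i' hi,
      main hT' hT h0' h0 hnT' hnT (fun p hp => (heq p hp).symm) i' i hi.symm⟩

/-! ### The two words that the formula separates. -/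

theorem IntInterval.mem_ioo {m n : ℤ} {h : m < n} {t : ℝ} :
    t ∈ (IntInterval.ioo m n h).toSet ↔ (m : ℝ) < t ∧ t < n := by
  simp [IntInterval.toSet, IntInterval.ioo, MemInterval]

/-- The time stamps of a word with labels `abcabc…` and period `1 - ε`; the `a` with number `M`
occurs `e * ε / 4` early. -/
noncomputable def abcTime (ε : ℝ) (e : ℕ) (M : ℤ) (p : ℤ) : ℝ :=
  (p / 3 : ℤ) * (1 - ε) +
    if p % 3 = 0 then (if p / 3 = M then -(e * ε / 4) else 0) else if p % 3 = 1 then ε / 2 else 1 / 2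

/-- The labels of the word `abcabc…`. -/
def abcLabel {S : Type*} (a b c : S) (p : ℤ) : S :=
  if p % 3 = 0 then a else if p % 3 = 1 then b else c

section

variable (ε : ℝ) (e : ℕ) (M q : ℤ)

theorem abcTime_zero : abcTime ε e M (3 * q) =
    q * (1 - ε) - if q = M then e * ε / 4 else 0 := by
  unfold abcTime
  rw [show 3 * q / 3 = q by omega, if_pos (by omega)]
  split_ifs <;> ring

theorem abcTime_one : abcTime ε e M (3 * q + 1) = q * (1 - ε) + ε / 2 := by
  unfold abcTime
  rw [show (3 * q + 1) / 3 = q by omega, if_neg (by omega), if_pos (by omega)]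

theorem abcTime_two : abcTime ε e M (3 * q + 2) = q * (1 - ε) + 1 / 2 := by
  unfold abcTime
  rw [show (3 * q + 2) / 3 = q by omega, if_neg (by omega), if_neg (by omega)]

end

theorem exists_eq_three_mul (p : ℤ) : ∃ q, p = 3 * q ∨ p = 3 * q + 1 ∨ p = 3 * q + 2 :=
  ⟨p / 3, by omega⟩

theorem tameTimes_abcTime {ε : ℝ} (h0 : 0 < ε) (h1 : ε ≤ 1 / 10) {e : ℕ} (he : e ≤ 3) (M : ℤ) :
    TameTimes (abcTime ε e M) := by
  have he' : (e : ℝ) ≤ 3 := by exact_mod_cast he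
  have hl : (0 : ℝ) ≤ e * ε / 4 := by positivity
  have hu : (e : ℝ) * ε / 4 ≤ 3 * ε / 4 := by gcongr
  constructor <;> intro p <;> obtain ⟨q, rfl | rfl | rfl⟩ := exists_eq_three_mul p
  · rw [abcTime_zero, abcTime_one]
    split_ifs <;> linarith
  · rw [add_assoc, one_add_one_eq_two, abcTime_one, abcTime_two]
    linarith
  · rw [show 3 * q + 2 + 1 = 3 * (q + 1) by ring, abcTime_zero, abcTime_two]
    push_cast
    split_ifs <;> linarith
  · rw [show 3 * q + 3 = 3 * (q + 1) by ring, abcTime_zero, abcTime_zero]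
    push_cast
    split_ifs <;> linarith
  · rw [show 3 * q + 1 + 3 = 3 * (q + 1) + 1 by ring, abcTime_one, abcTime_one]
    push_cast
    linarith
  · rw [show 3 * q + 2 + 3 = 3 * (q + 1) + 2 by ring, abcTime_two, abcTime_two]
    push_cast
    linarith
  · rw [show 3 * q + 3 = 3 * (q + 1) by ring, abcTime_zero, abcTime_zero]
    push_cast
    split_ifs <;> linarith
  · rw [show 3 * q + 1 + 3 = 3 * (q + 1) + 1 by ring, abcTime_one, abcTime_one]
    push_cast
    linarith
  · rw [show 3 * q + 2 + 3 = 3 * (q + 1) + 2 by ring, abcTime_two, abcTime_two]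
    push_cast
    linarith

/-- Time stamps are half-integers minus `sε/4`. Modulo 4, `s` is 0 for an ordinary `a` or a `c`, 2
for a `b`, and `e` for the displaced `a`; `a` and `c` are told apart by the half. -/
theorem abcTime_eq (ε : ℝ) (e : ℕ) (M p : ℤ) :
    ∃ s : ℤ, abcTime ε e M p = (p / 3 : ℤ) + ((if p % 3 = 2 then 1 else 0 : ℤ) : ℝ) / 2 - s * ε / 4 ∧
      s = 4 * (p / 3) + if p % 3 = 0 then (if p / 3 = M then (e : ℤ) else 0) else
        if p % 3 = 1 then -2 else 0 := by
  refine ⟨_, ?_, rfl⟩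
  unfold abcTime
  have : p % 3 = 0 ∨ p % 3 = 1 ∨ p % 3 = 2 := by omega
  rcases this with h | h | h <;> rw [h] <;> norm_num
  · split_ifs <;> ring
  · ring
  · ring

theorem nonIntegral_abcTime {ε : ℝ} (h0 : 0 < ε) {L : ℕ} (h1 : ε * (4 * L + 10) ≤ 1) {e : ℕ}
    (he : e = 0 ∨ e = 3) (M : ℤ) : NonIntegral L (abcTime ε e M) := by
  intro p q hp hpq hq z hz
  obtain ⟨s, hs, hs'⟩ := abcTime_eq ε e M p
  obtain ⟨t, ht, ht'⟩ := abcTime_eq ε e M q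
  rw [hs, ht] at hz
  generalize hu : (if p % 3 = 2 then 1 else 0 : ℤ) = u at hs hz
  generalize hv : (if q % 3 = 2 then 1 else 0 : ℤ) = v at ht hz
  have hb : |t - s| ≤ 4 * L + 10 := by
    rw [abs_le]
    rcases he with rfl | rfl <;> split_ifs at hs' ht' <;> constructor <;> omega
  have hb' : |((t - s : ℤ) : ℝ)| * ε ≤ 1 := by
    have : ((|t - s| : ℤ) : ℝ) ≤ 4 * L + 10 := by exact_mod_cast hb
    rw [Int.cast_abs] at this
    nlinarith
  have key : ((2 * (q / 3 - p / 3 - z) + (v - u) : ℤ) : ℝ) = ((t - s : ℤ) : ℝ) * ε / 2 := by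
    push_cast at hz ⊢
    linarith
  -- An integral distance equates this integer with a multiple of `ε` of size at most `1/2`, so both
  -- vanish.
  have hz0 : 2 * (q / 3 - p / 3 - z) + (v - u) = 0 := by
    rw [← Int.abs_lt_one_iff]
    have : |((2 * (q / 3 - p / 3 - z) + (v - u) : ℤ) : ℝ)| < 1 := by
      rw [key, abs_div, abs_mul, abs_of_pos h0, abs_two]
      linarith
    exact_mod_cast this
  have hts : t - s = 0 := by
    rw [hz0, Int.cast_zero] at key
    have : ((t - s : ℤ) : ℝ) * ε = 0 := by linarith
    rcases mul_eq_zero.1 this with h | h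
    · exact_mod_cast h
    · exact absurd h h0.ne'
  -- Equal `s` and equal halves force `p = q`. For `e = 3` this uses that 3 differs from 0 and 2
  -- modulo 4; `e = 2` would put some `b` at an integral distance from the early `a`.
  rcases he with rfl | rfl <;> split_ifs at hs' ht' hu hv <;> omega

theorem abcLabel_add_three {S : Type*} (a b c : S) (p : ℤ) :
    abcLabel a b c (p + 3) = abcLabel a b c p := by
  unfold abcLabel
  rw [Int.add_emod_right]

theorem TPTL1.mem_language_separating {S : Type*} {a b c : S} {ρ : TimedWord S} :
    ρ ∈ (TPTL1.separating a b c).language ↔ ∃ i j k : ρ.Pos, 0 < i ∧ i < j ∧ j < k ∧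
      a ∈ ρ.label i ∧ b ∈ ρ.label j ∧ c ∈ ρ.label k ∧
      (1 < ρ.time j - ρ.time i ∧ ρ.time j - ρ.time i < 2) ∧
      (1 < ρ.time k - ρ.time i ∧ ρ.time k - ρ.time i < 2) := by
  simp only [TPTL1.language, TPTL1.separating, TPTL1.dia, TPTL1.Sat, Set.mem_ofPred_eq,
    IntInterval.mem_ioo, Int.cast_one, Int.cast_ofNat, implies_true, and_true]
  constructor
  · rintro ⟨i, hi, ha, j, hj, ⟨hb, hbt, k, hk, hc, hct⟩⟩
    exact ⟨i, j, k, hi, hj, hk, ha, hb, hc, hbt, hct⟩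
  · rintro ⟨i, j, k, hi, hj, hk, ha, hb, hc, hbt, hct⟩
    exact ⟨i, hi, ha, j, hj, ⟨hb, hbt, k, hk, hc, hct⟩⟩

theorem abcLabel_cases {S : Type*} {a b c : S} (hab : a ≠ b) (hac : a ≠ c) (hbc : b ≠ c) (p : ℤ) :
    (a = abcLabel a b c p → p % 3 = 0) ∧ (b = abcLabel a b c p → p % 3 = 1) ∧
      (c = abcLabel a b c p → p % 3 = 2) := by
  have hp : p % 3 = 0 ∨ p % 3 = 1 ∨ p % 3 = 2 := by omega
  unfold abcLabel
  rcases hp with h | h | h <;> simp [h, hab, hac, hbc, hab.symm, hac.symm, hbc.symm]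

/-- In the word with regular time stamps no `a` is followed, between one and two time units later,
by a `b` and then a `c`. -/
theorem ofInt_notMem_language_separating {S : Type*} {a b c : S} (hab : a ≠ b) (hac : a ≠ c)
    (hbc : b ≠ c) {ε : ℝ} (h0 : 0 < ε) (h1 : ε ≤ 1 / 10) (L : ℕ) (M : ℤ)
    (hT : TameTimes (abcTime ε 0 M)) (hT0 : abcTime ε 0 M 0 = 0) :
    TimedWord.ofInt L (abcLabel a b c) (abcTime ε 0 M) hT hT0 ∉
      (TPTL1.separating a b c).language := by
  rw [TPTL1.mem_language_separating]
  rintro ⟨i, j, k, -, -, hjk, ha, hb, hc, ⟨hij, -⟩, -, hik⟩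
  change Fin (L + 1) at i j k
  have hjk' : (j : ℕ) < (k : ℕ) := hjk
  replace ha := (abcLabel_cases hab hac hbc _).1 ha
  replace hb := (abcLabel_cases hab hac hbc _).2.1 hb
  replace hc := (abcLabel_cases hab hac hbc _).2.2 hc
  simp only [TimedWord.ofInt] at hij hik
  obtain ⟨x, hx⟩ : ∃ x : ℤ, ((i : ℕ) : ℤ) = 3 * x := ⟨(i : ℕ) / 3, by omega⟩
  obtain ⟨y, hy⟩ : ∃ x : ℤ, ((j : ℕ) : ℤ) = 3 * x + 1 := ⟨(j : ℕ) / 3, by omega⟩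
  obtain ⟨z, hz⟩ : ∃ x : ℤ, ((k : ℕ) : ℤ) = 3 * x + 2 := ⟨(k : ℕ) / 3, by omega⟩
  rw [hx, hy, abcTime_zero, abcTime_one] at hij
  rw [hx, hz, abcTime_zero, abcTime_two] at hik
  simp only [Nat.cast_zero, zero_mul, zero_div, ite_self, sub_zero] at hij hik
  -- One period later the `b` is only `1 - ε/2` away.
  have hxy : x + 2 ≤ y := by
    by_contra hcon
    have : (y : ℝ) ≤ x + 1 := by exact_mod_cast (by omega : y ≤ x + 1)
    nlinarith
  have hxz : (x : ℝ) + 2 ≤ z := by exact_mod_cast (by omega : x + 2 ≤ z)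
  nlinarith

/-- In the word with one `a` occurring early, this `a` is followed, between one and two time units
later, by a `b` and then a `c`. -/
theorem ofInt_mem_language_separating {S : Type*} (a b c : S) {ε : ℝ} (h0 : 0 < ε)
    (h1 : ε ≤ 1 / 10) {L M : ℕ} (hM : 0 < M) (hML : 3 * M + 5 ≤ L)
    (hT : TameTimes (abcTime ε 3 M)) (hT0 : abcTime ε 3 M 0 = 0) :
    TimedWord.ofInt L (abcLabel a b c) (abcTime ε 3 M) hT hT0 ∈
      (TPTL1.separating a b c).language := by
  rw [TPTL1.mem_language_separating]
  have e1 := abcTime_zero ε 3 M M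
  have e2 := abcTime_one ε 3 M (M + 1)
  have e3 := abcTime_two ε 3 M (M + 1)
  rw [if_pos rfl] at e1
  push_cast at e1 e2 e3
  -- The early `a` and the `b` and `c` of the next period, at distances `1 + ε/4` and `3/2 - ε/4`.
  refine ⟨(⟨3 * M, by omega⟩ : Fin (L + 1)), (⟨3 * (M + 1) + 1, by omega⟩ : Fin (L + 1)),
    (⟨3 * (M + 1) + 2, by omega⟩ : Fin (L + 1)), ?_, ?_, ?_, ?_, ?_, ?_, ?_⟩
  · exact Fin.lt_def.2 (by simpa using hM)
  · exact Fin.lt_def.2 (by simp only; omega)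
  · exact Fin.lt_def.2 (by simp only; omega)
  · change a = abcLabel a b c _
    unfold abcLabel
    rw [if_pos (by push_cast; omega)]
  · change b = abcLabel a b c _
    unfold abcLabel
    rw [if_neg (by push_cast; omega), if_pos (by push_cast; omega)]
  · change c = abcLabel a b c _
    unfold abcLabel
    rw [if_neg (by push_cast; omega), if_neg (by push_cast; omega)]
  · simp only [TimedWord.ofInt]
    push_cast
    rw [e1, e2, e3]
    refine ⟨⟨?_, ?_⟩, ?_, ?_⟩ <;> linarith

theorem MTL.language_ne_separating {S : Type*} {a b c : S} (hab : a ≠ b) (hac : a ≠ c)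
    (hbc : b ≠ c) (φ : MTL S) : φ.language ≠ (TPTL1.separating a b c).language := by
  intro h
  obtain ⟨K, hK⟩ := φ.exists_constBeyond
  -- `M` is the full margin required; position `3M` of `0, …, 6M + 5` keeps it from both ends.
  obtain ⟨M, hM⟩ : ∃ M : ℕ, M = (φ.depth + 1) * (6 * K + 12) := ⟨_, rfl⟩
  have hM0 : 0 < M := by rw [hM]; positivity
  obtain ⟨L, hL⟩ : ∃ L : ℕ, L = 6 * M + 5 := ⟨_, rfl⟩
  -- `ε` is so small that the drift accumulated over the whole word cannot produce an integral
  -- distance.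
  obtain ⟨ε, hε⟩ : ∃ ε : ℝ, ε = 1 / (4 * L + 10) := ⟨_, rfl⟩
  have hpos : (0 : ℝ) < 4 * L + 10 := by positivity
  have h0 : 0 < ε := by rw [hε]; positivity
  have h1 : ε * (4 * L + 10) ≤ 1 := by rw [hε, div_mul_cancel₀ _ hpos.ne']
  have h2 : ε ≤ 1 / 10 := by
    have : (0 : ℝ) ≤ ε * L := by positivity
    linarith
  have hT := tameTimes_abcTime h0 h2 (e := 0) (by omega) M
  have hT' := tameTimes_abcTime h0 h2 (e := 3) (by omega) M
  have hz : ∀ e, abcTime ε e M 0 = 0 := by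
    intro e
    have := abcTime_zero ε e M 0
    rw [if_neg (by omega)] at this
    simpa using this
  have heq : ∀ p, p ≠ 3 * (M : ℤ) → abcTime ε 0 M p = abcTime ε 3 M p := by
    intro p hp
    obtain ⟨q, rfl | rfl | rfl⟩ := exists_eq_three_mul p
    · rw [abcTime_zero, abcTime_zero, if_neg (by omega), if_neg (by omega)]
    · rw [abcTime_one, abcTime_one]
    · rw [abcTime_two, abcTime_two]
  have hin : Inner L ((φ.depth + 1) * (6 * K + 12)) (3 * M) := by
    have : ((φ.depth : ℤ) + 1) * (6 * K + 12) = M := by rw [hM]; push_cast; ring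
    unfold Inner
    omega
  have key := MTL.sat_iff_of_agree (abcLabel_add_three a b c) φ hK φ.depth le_rfl hin hT hT'
    (hz 0) (hz 3) (nonIntegral_abcTime h0 h1 (Or.inl rfl) M)
    (nonIntegral_abcTime h0 h1 (Or.inr rfl) M) heq 0 0 (Or.inl rfl)
  refine ofInt_notMem_language_separating hab hac hbc h0 h2 L M hT (hz 0) ?_
  rw [← h]
  refine key.2 ?_
  have := ofInt_mem_language_separating a b c h0 h2 hM0 (L := L) (by omega) hT' (hz 3)
  rwa [← h] at this

theorem TPTL1.scopesSatisfy_separating {S : Type*} (a b c : S)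
    {R : IntInterval → IntInterval → Prop}
    (hR : R (.ioo 1 2 (by norm_num)) (.ioo 1 2 (by norm_num))) :
    (TPTL1.separating a b c).ScopesSatisfy R := by
  simp [TPTL1.separating, TPTL1.dia, TPTL1.ScopesSatisfy, TPTL1.outerIntervals, hR]

theorem IntInterval.ioo_hi_ne_lo {m n : ℤ} (h : m < n) :
    (IntInterval.ioo m n h).hi ≠ (IntInterval.ioo m n h).lo := by
  simp [IntInterval.ioo, h.ne']

end TimedLogic

theorem mainTheorem6 (S : Type*) [Finite S] :
    (∀ φ : TimedLogic.MTL S, φ.IsPMTL →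
      ∃ θ : TimedLogic.TPTL1 S, θ.IsPA ∧ θ.language = φ.language) ∧
    (∀ a b c : S, a ≠ b → a ≠ c → b ≠ c →
      (TimedLogic.TPTL1.separating a b c).IsNA ∧
      (TimedLogic.TPTL1.separating a b c).IsPA ∧
      (¬ ∃ φ : TimedLogic.MTL S,
        φ.language = (TimedLogic.TPTL1.separating a b c).language) ∧
      TimedLogic.PMTLDefinable S ⊂ TimedLogic.PADefinable S) := by
  refine ⟨fun φ hφ => hφ.exists_isPA, fun a b c hab hac hbc => ?_⟩
  have hne := TimedLogic.IntInterval.ioo_hi_ne_lo (m := 1) (n := 2) (by norm_num)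
  have hPA : (TimedLogic.TPTL1.separating a b c).IsPA :=
    Or.inl (TimedLogic.TPTL1.scopesSatisfy_separating a b c
      ⟨fun h => (hne h).elim, fun h => (hne h.symm).elim⟩)
  refine ⟨TimedLogic.TPTL1.scopesSatisfy_separating a b c
    ⟨fun h => (hne h).elim, fun h => (hne h.symm).elim⟩, hPA,
    fun ⟨φ, hφ⟩ => φ.language_ne_separating hab hac hbc hφ, ?_, fun hsub => ?_⟩
  · rintro _ ⟨φ, hφ, rfl⟩
    exact hφ.exists_isPA
  · obtain ⟨φ, -, hφ⟩ := hsub ⟨_, hPA, rfl⟩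
    exact φ.language_ne_separating hab hac hbc hφ
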